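/- For $l\ge 2$ let $$\xi_l=\int_{[0,1]^l}\frac{dx_1\cdots dx_l}{(1-x_1x_2)(1-x_2x_3)\cdots(1-x_{l-1}x_l)} .$$ For integers $m_1,\dots,m_r\ge 1$ with $m_r\ge 2$ let $\zeta(m_1,\dots,m_r)=\sum_{0<k_1<\dots<k_r}k_1^{-m_1}\cdots k_r^{-m_r}$. Put $\psi_0=1$ and, for $n\ge 1$, let $\psi_{2n}$ be the sum of all multiple zeta values $\zeta(m_1,\dots,m_r)$ such that $m_1+\dots+m_r=2n$, $m_r=2$, all $m_k\in\{1,2\}$, and $m_1+\dots+m_{k-1}$ is even whenever $m_k=2$ (that is, every entry $2$ is preceded by an even number of entries $1$). Define numbers $\beta^{(L)}_m$ for $L\ge 2$, $m\ge 0$ recursively by $\beta^{(2)}_1=1$ and, for $L\ge 2$, $1\le m\le L$, $m\equiv L \pmod 2$, $$\beta^{(L+1)}_m=\sum_{\substack{0\le n\le L-m\\ n\text{ even}}}\psi_n\,\beta^{(L)}_{m-1+n},$$ and $\beta^{(L)}_m=0$ for all other pairs $(L,m)$; in particular $\beta^{(L)}_0=0$. Then for every $l\ge 2$ the integral $\xi_l$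 converges absolutely and $$\xi_l=\begin{cases}\beta^{(l+2)}_1 & \text{if } l \text{ is even},\\ \beta^{(l+2)}_2 & \text{if } l\text{ is odd}.\end{cases}$$ -/

import Mathlib

open MeasureTheory

noncomputable section

/-- The multiple zeta value `ζ(m₁, …, m_r) = ∑_{0 < k₁ < ⋯ < k_r} ∏ⱼ 1 / kⱼ ^ mⱼ`
(the last exponent belongs to the largest summation variable). -/
def mzv {r : ℕ} (m : Fin r → ℕ) : ℝ :=
  ∑' k : {k : Fin r → ℕ // StrictMono k ∧ ∀ j, 0 < k j},
    ∏ j, (1 : ℝ) / (k.1 j : ℝ) ^ m j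

/-- The indices `(m₁, …, m_r)` of weight `N` over which `ψ_N` is summed: the last entry is `2`, all
entries are `1` or `2`, and `m₁ + ⋯ + m_{j-1}` is even whenever `m_j = 2` (in the word
`0^{m_r - 1} 1 ⋯ 0^{m_1 - 1} 1` of even weight `N`, all letters in even position are `1`). -/
def IsPsiIndex {N : ℕ} (c : Composition N) : Prop :=
  c.blocks.getLast? = some 2 ∧
    (∀ m ∈ c.blocks, m = 1 ∨ m = 2) ∧
    ∀ j : Fin c.length, c.blocksFun j = 2 → Even (c.sizeUpTo j)

instance {N : ℕ} : DecidablePred (IsPsiIndex (N := N)) := fun c => by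
  unfold IsPsiIndex; infer_instance

/-- `evenPsi n` is the number `ψ_{2n}`. -/
def evenPsi (n : ℕ) : ℝ :=
  if n = 0 then 1
  else ∑ c ∈ Finset.univ.filter (fun c : Composition (2 * n) => IsPsiIndex c), mzv c.blocksFun

/-- `betaCoeff ψ L m` is the number `β^{(L)}_m` attached to a sequence `ψ n = ψ_{2n}`:
`β^{(2)}_1 = 1`, and for `L ≥ 2`, `1 ≤ m ≤ L`, `m ≡ L (mod 2)`,
`β^{(L+1)}_m = ∑_{0 ≤ n ≤ L - m, n even} ψ_n β^{(L)}_{m - 1 + n}`,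
with `β^{(L)}_m = 0` for all other pairs (in particular for `m = 0`). -/
def betaCoeff (ψ : ℕ → ℝ) : ℕ → ℕ → ℝ
  | 0, _ => 0
  | 1, _ => 0
  | 2, m => if m = 1 then 1 else 0
  | _ + 3, 0 => 0
  | L + 3, m + 1 =>
      if m + 1 ≤ L + 2 ∧ m + 1 ≡ L + 2 [MOD 2] then
        ∑ k ∈ Finset.range ((L + 2 - (m + 1)) / 2 + 1), ψ k * betaCoeff ψ (L + 2) (m + 2 * k)
      else 0

/-- The function `∏_{i=1}^{l-1} 1 / (1 - xᵢ xᵢ₊₁)` of `l` real variables. -/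
def xiIntegrand (l : ℕ) (x : Fin l → ℝ) : ℝ :=
  ∏ i : Fin (l - 1), 1 / (1 - x ⟨i.1, by omega⟩ * x ⟨i.1 + 1, by omega⟩)

/-- The integral `ξ_l` of `xiIntegrand l` over the unit cube `[0, 1]^l`. -/
def xiInt (l : ℕ) : ℝ :=
  ∫ x in Set.Icc (0 : Fin l → ℝ) 1, xiIntegrand l x

end

/-! Expanding each kernel in a geometric series turns the cube integral into the `(0, 0)` entry of
the `l`-th power of the Hilbert matrix `H = (1 / (m + n + 1))`. All terms are nonnegative, so this
also gives absolute convergence (`integrableOn_xiIntegrand`, `xiInt_eq_hilbertIter`).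

On coefficient sequences let `D f = (1 - y)(y f)'` and `U f = (1 - y) f'`. Summation by parts gives
`D H = H U + f(0) e₀` and `U H = H D`. Hence `D` and `U`, applied to iterates of `e₀`, return
convolutions of iterates (`lowerDiff_hilbertIter_and_upperDiff_hilbertIter`). For the generating
series `E_N`, `O_N` of even and odd iterates at index `N`, these are first-order recurrences in `N`.
With `ρ = E_0`, their solution is a truncated version of the `ψ` sums evaluated at `λ² = X ρ²`
(`oddSeries_eq_and_evenSeries_eq`).

Since `ρ = 1 + X ∑ O_N / (N + 1)`, it follows that `ρ = Ψ(X ρ²)` (`evenSeries_zero_eq`). Multiplying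
by `ρ^m` and comparing coefficients reproduces the recursion for `β`, so `β^{(L)}_m = [X^n] ρ^m`
when `L = m + 1 + 2 n` (`betaCoeff_psiSeries`). The cases `m = 1, 2` are the claim, because `O_0 =
ρ²`. -/

/-! ### Iterates of the Hilbert matrix and their decay -/

/-- The Hilbert matrix `(1 / (m + n + 1))` applied to a sequence. -/
noncomputable def hilbertMap (f : ℕ → ℝ) (m : ℕ) : ℝ :=
  ∑' n : ℕ, f n / ((m : ℝ) + n + 1)

/-- The sequence obtained by applying the Hilbert matrix `l` times to the first unit vector. -/
noncomputable def hilbertIter : ℕ → ℕ → ℝ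
  | 0 => fun n => if n = 0 then 1 else 0
  | l + 1 => hilbertMap (hilbertIter l)

/-- Domination by a negative power. -/
def PowDecay (f : ℕ → ℝ) : Prop :=
  ∃ C ε : ℝ, 0 < ε ∧ ε ≤ 1 ∧ ∀ n : ℕ, |f n| ≤ C * ((n : ℝ) + 1) ^ (-ε)

theorem summable_add_one_rpow {p : ℝ} (hp : p < -1) :
    Summable fun n : ℕ => ((n : ℝ) + 1) ^ p := by
  have := (summable_nat_add_iff 1).2 (Real.summable_nat_rpow.2 hp)
  simpa using this

/-- Splitting `m + n + 1` multiplicatively with exponents `ε / 2` and `1 - ε / 2` leaves a summable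
power of `n + 1` and decay in `m`. Each application of the matrix thus costs half of the exponent.
-/
theorem PowDecay.div_le {f : ℕ → ℝ} {C ε : ℝ} (hε : 0 < ε) (hε1 : ε ≤ 1)
    (hf : ∀ n : ℕ, |f n| ≤ C * ((n : ℝ) + 1) ^ (-ε)) (m n : ℕ) :
    |f n / ((m : ℝ) + n + 1)| ≤
      (C * ((m : ℝ) + 1) ^ (-(ε / 2))) * ((n : ℝ) + 1) ^ (-1 - ε / 2) := by
  set a := ε / 2 with ha
  have ha0 : 0 < a := by positivity
  have hm : (0 : ℝ) < (m : ℝ) + 1 := by positivity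
  have hn : (0 : ℝ) < (n : ℝ) + 1 := by positivity
  have hn1 : (1 : ℝ) ≤ (n : ℝ) + 1 := by simp
  have hC : 0 ≤ C := by
    have := (abs_nonneg _).trans (hf 0)
    simpa using this
  have key : ((m : ℝ) + 1) ^ a * ((n : ℝ) + 1) ^ (1 - a) ≤ (m : ℝ) + n + 1 := by
    calc _ ≤ ((m : ℝ) + n + 1) ^ a * ((m : ℝ) + n + 1) ^ (1 - a) := by
          gcongr <;> linarith
      _ = _ := by rw [← Real.rpow_add (by positivity)]; simp
  rw [abs_div, abs_of_pos (show (0 : ℝ) < (m : ℝ) + n + 1 by positivity)]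
  calc |f n| / ((m : ℝ) + n + 1)
      ≤ C * ((n : ℝ) + 1) ^ (-ε) / (((m : ℝ) + 1) ^ a * ((n : ℝ) + 1) ^ (1 - a)) := by
        gcongr; exact hf n
    _ = C * ((m : ℝ) + 1) ^ (-a) * ((n : ℝ) + 1) ^ (-ε - (1 - a)) := by
        rw [Real.rpow_sub hn (-ε), Real.rpow_neg hm.le]
        ring
    _ = _ := by congr 2; rw [ha]; ring

theorem PowDecay.summable {f : ℕ → ℝ} (hf : PowDecay f) (m : ℕ) :
    Summable fun n : ℕ => f n / ((m : ℝ) + n + 1) := by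
  obtain ⟨C, ε, hε, hε1, h⟩ := hf
  refine Summable.of_norm_bounded (g := fun n : ℕ => (C * ((m : ℝ) + 1) ^ (-(ε / 2))) *
    ((n : ℝ) + 1) ^ (-1 - ε / 2)) ?_ (fun n => PowDecay.div_le hε hε1 h m n)
  exact (summable_add_one_rpow (by linarith)).mul_left _

theorem PowDecay.hilbertMap {f : ℕ → ℝ} (hf : PowDecay f) : PowDecay (hilbertMap f) := by
  obtain ⟨C, ε, hε, hε1, h⟩ := hf
  have hs := summable_add_one_rpow (p := -1 - ε / 2) (by linarith)
  refine ⟨C * ∑' n : ℕ, ((n : ℝ) + 1) ^ (-1 - ε / 2), ε / 2, by positivity, by linarith, fun m => ?_⟩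
  have := tsum_of_norm_bounded (f := fun n : ℕ => f n / ((m : ℝ) + n + 1))
    (hs.hasSum.mul_left (C * ((m : ℝ) + 1) ^ (-(ε / 2)))) (fun n => PowDecay.div_le hε hε1 h m n)
  rw [Real.norm_eq_abs] at this
  unfold _root_.hilbertMap
  linarith

theorem PowDecay.tendsto_zero {f : ℕ → ℝ} (hf : PowDecay f) :
    Filter.Tendsto f Filter.atTop (nhds 0) := by
  obtain ⟨C, ε, hε, hε1, h⟩ := hf
  refine squeeze_zero_norm h ?_
  have h1 : Filter.Tendsto (fun n : ℕ => (n : ℝ) + 1) Filter.atTop Filter.atTop :=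
    Filter.tendsto_atTop_add_const_right _ _ tendsto_natCast_atTop_atTop
  simpa using ((tendsto_rpow_neg_atTop hε).comp h1).const_mul C

theorem powDecay_hilbertIter (l : ℕ) : PowDecay (hilbertIter l) := by
  induction l with
  | zero =>
    refine ⟨1, 1, one_pos, le_rfl, fun n => ?_⟩
    by_cases hn : n = 0
    · simp [hilbertIter, hn]
    · simp only [hilbertIter, hn, if_false, abs_zero]; positivity
  | succ l ih => exact ih.hilbertMap

theorem hilbertIter_nonneg (l n : ℕ) : 0 ≤ hilbertIter l n := by
  induction l generalizing n with
  | zero => simp only [hilbertIter]; split_ifs <;> norm_num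
  | succ l ih => exact tsum_nonneg fun k => div_nonneg (ih k) (by positivity)

/-! ### Commutation of the Hilbert matrix with two differential operators -/

/-- The operator `f ↦ (1 - y) (y f)'` on the coefficients of power series. -/
def lowerDiff (f : ℕ → ℝ) (n : ℕ) : ℝ := ((n : ℝ) + 1) * f n - n * f (n - 1)

/-- The operator `f ↦ (1 - y) f'` on the coefficients of power series. -/
def upperDiff (f : ℕ → ℝ) (n : ℕ) : ℝ := ((n : ℝ) + 1) * f (n + 1) - n * f n

theorem tsum_eq_of_telescope {g p u : ℕ → ℝ} (hg : Summable g) (hp : Summable p)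
    (hu : Filter.Tendsto u Filter.atTop (nhds 0)) (h : ∀ n, g n - p n = u (n + 1) - u n) :
    ∑' n, g n = ∑' n, p n - u 0 := by
  have h1 := (hg.sub hp).hasSum.tendsto_sum_nat
  have h2 : Filter.Tendsto (fun n => ∑ i ∈ Finset.range n, (g i - p i)) Filter.atTop
      (nhds (0 - u 0)) := by
    simp_rw [h, Finset.sum_range_sub]
    exact hu.sub_const _
  have h3 := tendsto_nhds_unique h1 h2
  rw [hg.tsum_sub hp] at h3
  linarith

/-- Summation by parts with primitive `n f(n) / (m + n)` in row `m`. It vanishes at `n = 0` unless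
`m = 0`; there its role is taken by `f(n)`, whose boundary value is the extra term. -/
theorem lowerDiff_hilbertMap {f : ℕ → ℝ} (hf : PowDecay f)
    (hs : ∀ m : ℕ, Summable fun n : ℕ => upperDiff f n / ((m : ℝ) + n + 1)) (m : ℕ) :
    lowerDiff (hilbertMap f) m = hilbertMap (upperDiff f) m + if m = 0 then f 0 else 0 := by
  rcases m with _ | m
  · have := tsum_eq_of_telescope (g := fun n => upperDiff f n / ((0 : ℕ) + (n : ℝ) + 1))
      (p := fun n => f n / ((0 : ℕ) + (n : ℝ) + 1)) (u := f) (hs 0) (hf.summable 0)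
      hf.tendsto_zero (fun n => by
        have : (n : ℝ) + 1 ≠ 0 := by positivity
        simp only [upperDiff, Nat.cast_zero, zero_add]
        field_simp
        ring)
    simp only [lowerDiff, hilbertMap, this]
    simp
  · have hs1 := (hf.summable (m + 1)).mul_left ((m : ℝ) + 2)
    have hs2 := (hf.summable m).mul_left ((m : ℝ) + 1)
    have := tsum_eq_of_telescope (g := fun n => upperDiff f n / (((m + 1 : ℕ) : ℝ) + n + 1))
      (p := fun n => ((m : ℝ) + 2) * (f n / (((m + 1 : ℕ) : ℝ) + n + 1))
        - ((m : ℝ) + 1) * (f n / ((m : ℝ) + n + 1)))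
      (u := fun n => n / ((m : ℝ) + n + 1) * f n) (hs (m + 1)) (hs1.sub hs2)
      (by
        refine squeeze_zero_norm (fun n => ?_) (tendsto_zero_iff_norm_tendsto_zero.1 hf.tendsto_zero)
        rw [norm_mul]
        refine mul_le_of_le_one_left (norm_nonneg _) ?_
        rw [Real.norm_of_nonneg (by positivity)]
        exact div_le_one_of_le₀ (by linarith [(Nat.cast_nonneg m : (0 : ℝ) ≤ m)]) (by positivity))
      (fun n => by
        have h1 : (m : ℝ) + n + 1 ≠ 0 := by positivity
        have h2 : (m : ℝ) + n + 2 ≠ 0 := by positivity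
        simp only [upperDiff]
        push_cast
        rw [show (m : ℝ) + 1 + n + 1 = m + n + 2 by ring,
          show (m : ℝ) + (n + 1) + 1 = m + n + 2 by ring]
        field_simp
        ring)
    rw [hs1.tsum_sub hs2, tsum_mul_left, tsum_mul_left] at this
    simp only [lowerDiff, hilbertMap, this]
    simp only [Nat.cast_add, Nat.cast_one, Nat.add_sub_cancel, CharP.cast_eq_zero, zero_div,
      zero_mul, sub_zero, Nat.add_eq_zero_iff, one_ne_zero, and_false, if_false, add_zero]
    ring

theorem upperDiff_hilbertMap {f : ℕ → ℝ} (hf : PowDecay f)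
    (hs : ∀ m : ℕ, Summable fun n : ℕ => lowerDiff f n / ((m : ℝ) + n + 1)) (m : ℕ) :
    upperDiff (hilbertMap f) m = hilbertMap (lowerDiff f) m := by
  have hs1 := (hf.summable (m + 1)).mul_left ((m : ℝ) + 1)
  have hs2 := (hf.summable m).mul_left (m : ℝ)
  have := tsum_eq_of_telescope (g := fun n => lowerDiff f n / ((m : ℝ) + n + 1))
    (p := fun n => ((m : ℝ) + 1) * (f n / (((m + 1 : ℕ) : ℝ) + n + 1))
      - m * (f n / ((m : ℝ) + n + 1)))
    (u := fun n => n / ((m : ℝ) + n + 1) * f (n - 1)) (hs m) (hs1.sub hs2)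
    (by
      refine squeeze_zero_norm (fun n => ?_)
        (tendsto_zero_iff_norm_tendsto_zero.1
          (hf.tendsto_zero.comp (Filter.tendsto_sub_atTop_nat 1)))
      rw [norm_mul]
      refine mul_le_of_le_one_left (norm_nonneg _) ?_
      rw [Real.norm_of_nonneg (by positivity)]
      exact div_le_one_of_le₀ (by linarith [(Nat.cast_nonneg m : (0 : ℝ) ≤ m)]) (by positivity))
    (fun n => by
      have h1 : (m : ℝ) + n + 1 ≠ 0 := by positivity
      have h2 : (m : ℝ) + n + 2 ≠ 0 := by positivity
      simp only [lowerDiff, Nat.add_sub_cancel]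
      push_cast
      rw [show (m : ℝ) + 1 + n + 1 = m + n + 2 by ring,
        show (m : ℝ) + (n + 1) + 1 = m + n + 2 by ring]
      field_simp
      ring)
  rw [hs1.tsum_sub hs2, tsum_mul_left, tsum_mul_left] at this
  simp only [upperDiff, hilbertMap, this]
  simp

theorem summable_sum_hilbertIter (n m : ℕ) (c : ℕ × ℕ → ℝ) (k : ℕ × ℕ → ℕ) :
    Summable fun j : ℕ => (∑ p ∈ Finset.HasAntidiagonal.antidiagonal n, c p * hilbertIter (k p) j)
      / ((m : ℝ) + j + 1) := by
  simp_rw [Finset.sum_div, mul_div_assoc]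
  exact summable_sum fun p _ => ((powDecay_hilbertIter _).summable m).mul_left _

theorem hilbertMap_sum_hilbertIter (n m : ℕ) (c : ℕ × ℕ → ℝ) (k : ℕ × ℕ → ℕ) :
    hilbertMap (fun j => ∑ p ∈ Finset.HasAntidiagonal.antidiagonal n, c p * hilbertIter (k p) j) m
      = ∑ p ∈ Finset.HasAntidiagonal.antidiagonal n, c p * hilbertIter (k p + 1) m := by
  simp_rw [hilbertMap, Finset.sum_div, mul_div_assoc]
  rw [Summable.tsum_finsetSum fun p _ => ((powDecay_hilbertIter _).summable m).mul_left _]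
  simp_rw [tsum_mul_left]
  rfl

/-- The two commutation rules alternate, and each `D H` step adds one multiple of `e₀`. The formula
for one iterate also supplies the summability required at the next. -/
theorem lowerDiff_hilbertIter_and_upperDiff_hilbertIter (n : ℕ) :
    lowerDiff (hilbertIter (2 * n + 1)) = (fun m => ∑ p ∈ Finset.HasAntidiagonal.antidiagonal n,
        hilbertIter (2 * p.1) 0 * hilbertIter (2 * p.2) m) ∧
      upperDiff (hilbertIter (2 * n + 2)) = (fun m => ∑ p ∈ Finset.HasAntidiagonal.antidiagonal n,
        hilbertIter (2 * p.1) 0 * hilbertIter (2 * p.2 + 1) m) := by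
  have step : ∀ n : ℕ, lowerDiff (hilbertIter (2 * n + 1)) = (fun m =>
      ∑ p ∈ Finset.HasAntidiagonal.antidiagonal n, hilbertIter (2 * p.1) 0 * hilbertIter (2 * p.2) m) →
      upperDiff (hilbertIter (2 * n + 2)) = (fun m => ∑ p ∈ Finset.HasAntidiagonal.antidiagonal n,
        hilbertIter (2 * p.1) 0 * hilbertIter (2 * p.2 + 1) m) := fun n h => by
    funext m
    have h1 := upperDiff_hilbertMap (powDecay_hilbertIter (2 * n + 1))
      (fun m => by rw [h]; exact summable_sum_hilbertIter n m _ _) m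
    rw [h, hilbertMap_sum_hilbertIter] at h1
    exact h1
  suffices hl : lowerDiff (hilbertIter (2 * n + 1)) = (fun m => ∑ p ∈ Finset.HasAntidiagonal.antidiagonal n,
      hilbertIter (2 * p.1) 0 * hilbertIter (2 * p.2) m) from ⟨hl, step n hl⟩
  induction n with
  | zero =>
    have h0 : upperDiff (hilbertIter 0) = fun _ => 0 := by
      funext n
      rcases n with _ | n <;> simp [upperDiff, hilbertIter]
    funext m
    have h1 := lowerDiff_hilbertMap (powDecay_hilbertIter 0)
      (fun m => by simp [h0, summable_zero]) m
    rw [h0] at h1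
    simp only [Nat.mul_zero, zero_add, Finset.HasAntidiagonal.antidiagonal_zero, Finset.sum_singleton]
    refine h1.trans ?_
    simp [hilbertMap, hilbertIter]
  | succ n ih =>
    have h := step n ih
    funext m
    have h1 := lowerDiff_hilbertMap (powDecay_hilbertIter (2 * n + 2))
      (fun m => by rw [h]; exact summable_sum_hilbertIter n m _ _) m
    rw [h, hilbertMap_sum_hilbertIter] at h1
    refine h1.trans ?_
    -- The boundary term is the summand `(n + 1, 0)`.
    rw [Finset.Nat.sum_antidiagonal_succ', add_comm]
    simp [hilbertIter, mul_add]
-- Generating series and their recurrences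
open PowerSeries (coeff X C mk)

/-- Generating series of `hilbertIter (2 n) m` over `n`. -/
noncomputable def evenSeries (m : ℕ) : PowerSeries ℝ := mk fun n => hilbertIter (2 * n) m

/-- Generating series of `hilbertIter (2 n + 1) m` over `n`. -/
noncomputable def oddSeries (m : ℕ) : PowerSeries ℝ := mk fun n => hilbertIter (2 * n + 1) m

theorem oddSeries_zero : oddSeries 0 = evenSeries 0 * evenSeries 0 := by
  ext n
  have h := congrFun (lowerDiff_hilbertIter_and_upperDiff_hilbertIter n).1 0
  simp only [lowerDiff, CharP.cast_eq_zero, zero_add, one_mul, zero_mul, sub_zero] at h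
  simp [oddSeries, evenSeries, PowerSeries.coeff_mul, h]

theorem oddSeries_succ (m : ℕ) :
    ((m : ℝ) + 2) • oddSeries (m + 1)
      = ((m : ℝ) + 1) • oddSeries m + evenSeries 0 * evenSeries (m + 1) := by
  ext n
  have h := congrFun (lowerDiff_hilbertIter_and_upperDiff_hilbertIter n).1 (m + 1)
  simp only [lowerDiff, Nat.cast_add, Nat.cast_one, Nat.add_sub_cancel] at h
  simp only [oddSeries, evenSeries, map_add, map_smul, smul_eq_mul, PowerSeries.coeff_mk,
    PowerSeries.coeff_mul]
  linarith

theorem evenSeries_succ (m : ℕ) :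
    ((m : ℝ) + 1) • evenSeries (m + 1)
      = (m : ℝ) • evenSeries m + X * (evenSeries 0 * oddSeries m) := by
  ext n
  rcases n with _ | n
  · rcases m with _ | m <;> simp [evenSeries, hilbertIter]
  · have h := congrFun (lowerDiff_hilbertIter_and_upperDiff_hilbertIter n).2 m
    simp only [upperDiff] at h
    rw [map_add, PowerSeries.coeff_succ_X_mul]
    simp only [oddSeries, evenSeries, map_smul, smul_eq_mul, PowerSeries.coeff_mk,
      PowerSeries.coeff_mul, mul_add, mul_one]
    linarith

/-! ### Substitution of `X g` into a power series -/

/-- The series `∑ c_k X^k g^k`. -/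
noncomputable def shiftEval (g : PowerSeries ℝ) (c : ℕ → ℝ) : PowerSeries ℝ :=
  mk fun n => ∑ k ∈ Finset.range (n + 1), c k * coeff n ((X * g) ^ k)

theorem coeff_mul_X_mul_pow (f g : PowerSeries ℝ) (n k : ℕ) :
    coeff n (f * (X * g) ^ k) = if k ≤ n then coeff (n - k) (f * g ^ k) else 0 := by
  rw [mul_pow, mul_left_comm, PowerSeries.coeff_X_pow_mul']

theorem coeff_X_mul_pow_of_lt (g : PowerSeries ℝ) {n k : ℕ} (h : n < k) :
    coeff n ((X * g) ^ k) = 0 := by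
  have := coeff_mul_X_mul_pow 1 g n k
  rwa [one_mul, if_neg (by omega)] at this

theorem coeff_shiftEval (g : PowerSeries ℝ) (c : ℕ → ℝ) {n N : ℕ} (h : n < N) :
    coeff n (shiftEval g c) = ∑ k ∈ Finset.range N, c k * coeff n ((X * g) ^ k) := by
  rw [shiftEval, PowerSeries.coeff_mk]
  refine Finset.sum_subset (by simpa using h) fun k _ hk => ?_
  rw [coeff_X_mul_pow_of_lt g (by simpa using hk), mul_zero]

theorem coeff_mul_shiftEval (f g : PowerSeries ℝ) (c : ℕ → ℝ) (n : ℕ) :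
    coeff n (f * shiftEval g c)
      = ∑ k ∈ Finset.range (n + 1), c k * coeff n (f * (X * g) ^ k) := by
  simp_rw [PowerSeries.coeff_mul, Finset.mul_sum]
  rw [Finset.sum_comm]
  refine Finset.sum_congr rfl fun p hp => ?_
  have := Finset.HasAntidiagonal.mem_antidiagonal.1 hp
  rw [coeff_shiftEval g c (show p.2 < n + 1 by omega), Finset.mul_sum]
  exact Finset.sum_congr rfl fun k _ => by ring

theorem shiftEval_add (g : PowerSeries ℝ) (c d : ℕ → ℝ) :
    shiftEval g (fun k => c k + d k) = shiftEval g c + shiftEval g d := by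
  ext n
  simp [shiftEval, add_mul, Finset.sum_add_distrib]

theorem shiftEval_smul (g : PowerSeries ℝ) (a : ℝ) (c : ℕ → ℝ) :
    shiftEval g (fun k => a * c k) = a • shiftEval g c := by
  ext n
  simp [shiftEval, Finset.mul_sum, mul_assoc]

theorem shiftEval_cons (g : PowerSeries ℝ) (a : ℝ) (c : ℕ → ℝ) :
    shiftEval g (fun k => Nat.casesOn k a c) = C a + X * g * shiftEval g c := by
  ext n
  rw [map_add, coeff_mul_shiftEval, shiftEval, PowerSeries.coeff_mk, Finset.sum_range_succ',
    Finset.sum_range_succ, ← pow_succ', coeff_X_mul_pow_of_lt g (Nat.lt_succ_self n)]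
  simp [PowerSeries.coeff_C, PowerSeries.coeff_one, pow_succ', add_comm]

/-! ### Truncated `ψ` sums solve the recurrences -/

/-- The truncated sums `∑ k₁^{-m₁} ⋯ k_r^{-m_r}` over `0 < k₁ < ⋯ < k_r ≤ N` and over all indices of
weight `s` with entries in `{1, 2}` in which every entry `2` is preceded by an even weight. -/
noncomputable def truncPsi : ℕ → ℕ → ℝ
  | 0, s => if s = 0 then 1 else 0
  | N + 1, 0 => truncPsi N 0
  | N + 1, 1 => truncPsi N 1 + truncPsi N 0 / ((N : ℝ) + 1)
  | N + 1, s + 2 => truncPsi N (s + 2) + truncPsi N (s + 1) / ((N : ℝ) + 1)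
      + if Even s then truncPsi N s / ((N : ℝ) + 1) ^ 2 else 0

theorem truncPsi_nonneg (N s : ℕ) : 0 ≤ truncPsi N s := by
  induction N generalizing s with
  | zero => simp only [truncPsi]; split_ifs <;> norm_num
  | succ N ih =>
    have h := fun s => ih s
    rcases s with _ | _ | s
    · exact ih 0
    · simp only [truncPsi]; have := ih 0; have := ih 1; positivity
    · simp only [truncPsi]
      have := ih s; have := ih (s + 1); have := ih (s + 2)
      split_ifs <;> positivity

theorem truncPsi_zero_right (N : ℕ) : truncPsi N 0 = 1 := by
  induction N with
  | zero => simp [truncPsi]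
  | succ N ih => simpa [truncPsi] using ih

theorem truncPsi_odd_succ (N k : ℕ) :
    truncPsi (N + 1) (2 * k + 1)
      = truncPsi N (2 * k + 1) + (1 / ((N : ℝ) + 1)) * truncPsi N (2 * k) := by
  rcases k with _ | k
  · simp [truncPsi]; ring
  · rw [show 2 * (k + 1) + 1 = 2 * k + 1 + 2 by ring, truncPsi, if_neg (by simp)]
    ring_nf

/-- Exponents `1` and `2` of the new variable `N + 1` combine: removing one factor `1 / (N + 1)`
leaves an odd-weight sum in which `N + 1` may still occur once. This explains the bound `N + 1` on
the right. -/
theorem truncPsi_even_succ (N k : ℕ) :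
    truncPsi (N + 1) (2 * k + 2)
      = truncPsi N (2 * k + 2) + (1 / ((N : ℝ) + 1)) * truncPsi (N + 1) (2 * k + 1) := by
  rw [truncPsi_odd_succ, truncPsi, if_pos (by simp)]
  field_simp
  ring

/-- `∑ truncPsi N (2 k) λ^{2 k}` at `λ² = X ρ²`, where `ρ = evenSeries 0`. -/
noncomputable def evenTrunc (N : ℕ) : PowerSeries ℝ :=
  shiftEval (evenSeries 0 * evenSeries 0) fun k => truncPsi N (2 * k)

/-- `∑ truncPsi N (2 k + 1) λ^{2 k}` at `λ² = X ρ²`, where `ρ = evenSeries 0`. -/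
noncomputable def oddTrunc (N : ℕ) : PowerSeries ℝ :=
  shiftEval (evenSeries 0 * evenSeries 0) fun k => truncPsi N (2 * k + 1)

theorem oddTrunc_succ (N : ℕ) :
    oddTrunc (N + 1) = oddTrunc N + (1 / ((N : ℝ) + 1)) • evenTrunc N := by
  simp only [oddTrunc, evenTrunc, truncPsi_odd_succ]
  rw [shiftEval_add, shiftEval_smul]

theorem evenTrunc_eq (N : ℕ) : evenTrunc N = C 1 + X * (evenSeries 0 * evenSeries 0) *
    shiftEval (evenSeries 0 * evenSeries 0) fun k => truncPsi N (2 * k + 2) := by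
  rw [evenTrunc, ← shiftEval_cons]
  congr 1
  funext k
  rcases k with _ | k
  · exact truncPsi_zero_right N
  · rfl

theorem evenTrunc_succ (N : ℕ) : evenTrunc (N + 1) = evenTrunc N +
    (1 / ((N : ℝ) + 1)) • (X * (evenSeries 0 * evenSeries 0) * oddTrunc (N + 1)) := by
  rw [evenTrunc_eq, evenTrunc_eq]
  simp only [truncPsi_even_succ]
  rw [shiftEval_add, shiftEval_smul, oddTrunc, mul_add, mul_smul_comm, add_assoc]

theorem evenTrunc_zero : evenTrunc 0 = 1 := by
  rw [evenTrunc_eq]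
  have : (shiftEval (evenSeries 0 * evenSeries 0) fun k => truncPsi 0 (2 * k + 2)) = 0 := by
    ext n; simp [shiftEval, truncPsi]
  rw [this]; simp

theorem oddTrunc_zero : oddTrunc 0 = 0 := by
  ext n; simp [oddTrunc, shiftEval, truncPsi]

/-- Both sides satisfy the same coupled recurrence. The even identity at `N + 1` comes first, since
the odd one uses it. -/
theorem oddSeries_eq_and_evenSeries_eq (N : ℕ) :
    ((N : ℝ) + 1) • oddSeries N = evenSeries 0 * evenSeries 0 * evenTrunc N ∧
      (N : ℝ) • evenSeries N
        = X * (evenSeries 0 * evenSeries 0 * evenSeries 0) * oddTrunc N := by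
  induction N with
  | zero => simp [oddSeries_zero, evenTrunc_zero, oddTrunc_zero]
  | succ N ih =>
    have hN : (N : ℝ) + 1 ≠ 0 := by positivity
    have ho : oddSeries N = (1 / ((N : ℝ) + 1)) • (evenSeries 0 * evenSeries 0 * evenTrunc N) := by
      rw [← ih.1, smul_smul, one_div, inv_mul_cancel₀ hN, one_smul]
    have he : ((N : ℝ) + 1) • evenSeries (N + 1)
        = X * (evenSeries 0 * evenSeries 0 * evenSeries 0) * oddTrunc (N + 1) := by
      rw [evenSeries_succ, ih.2, ho, oddTrunc_succ]
      simp only [mul_add, mul_smul_comm]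
      congr 2
      ring
    refine ⟨?_, by exact_mod_cast he⟩
    have he' : evenSeries (N + 1) = (1 / ((N : ℝ) + 1)) •
        (X * (evenSeries 0 * evenSeries 0 * evenSeries 0) * oddTrunc (N + 1)) := by
      rw [← he, smul_smul, one_div, inv_mul_cancel₀ hN, one_smul]
    push_cast
    rw [add_assoc, one_add_one_eq_two, oddSeries_succ, ih.1, he', evenTrunc_succ]
    simp only [mul_add, mul_smul_comm]
    congr 2
    ring

theorem coeff_zero_evenSeries : coeff 0 (evenSeries 0) = 1 := by
  simp [evenSeries, hilbertIter]

/-! ### The functional equation and the numbers `β` -/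

/-- The numbers `ψ_{2k}` as single series. -/
noncomputable def psiSeries : ℕ → ℝ
  | 0 => 1
  | k + 1 => ∑' N : ℕ, truncPsi N (2 * k) / ((N : ℝ) + 1) ^ 2

theorem hilbertIter_odd_eq (N n : ℕ) :
    hilbertIter (2 * n + 1) N / ((N : ℝ) + 1) = ∑ k ∈ Finset.range (n + 1),
      truncPsi N (2 * k) / ((N : ℝ) + 1) ^ 2 *
        coeff n (evenSeries 0 * evenSeries 0 * (X * (evenSeries 0 * evenSeries 0)) ^ k) := by
  have h := congrArg (coeff n) (oddSeries_eq_and_evenSeries_eq N).1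
  rw [evenTrunc, coeff_mul_shiftEval, map_smul, oddSeries, PowerSeries.coeff_mk, smul_eq_mul] at h
  have hN : (N : ℝ) + 1 ≠ 0 := by positivity
  simp_rw [div_mul_eq_mul_div]
  rw [← Finset.sum_div, ← h]
  field_simp

theorem coeff_evenSeries_pow_nonneg (n k : ℕ) : 0 ≤ coeff n (evenSeries 0 ^ k) := by
  induction k generalizing n with
  | zero => rw [pow_zero, PowerSeries.coeff_one]; split_ifs <;> norm_num
  | succ k ih =>
    rw [pow_succ, PowerSeries.coeff_mul]
    refine Finset.sum_nonneg fun p _ => mul_nonneg (ih _) ?_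
    rw [evenSeries, PowerSeries.coeff_mk]
    exact hilbertIter_nonneg _ _

theorem coeff_sq_mul_shift (n k : ℕ) :
    coeff n (evenSeries 0 * evenSeries 0 * (X * (evenSeries 0 * evenSeries 0)) ^ k)
      = if k ≤ n then coeff (n - k) (evenSeries 0 ^ (2 * k + 2)) else 0 := by
  rw [coeff_mul_X_mul_pow]
  congr 2
  ring

/-- Convergence is inherited from the iterates: in the nonnegative expansion of iterate `2 k + 1`,
the last term carries the coefficient `1`, so it is dominated by a convergent series. -/
theorem summable_truncPsi (k : ℕ) :
    Summable fun N : ℕ => truncPsi N (2 * k) / ((N : ℝ) + 1) ^ 2 := by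
  have hs := (powDecay_hilbertIter (2 * k + 1)).summable 0
  simp only [CharP.cast_eq_zero, zero_add] at hs
  refine Summable.of_nonneg_of_le
    (fun N => div_nonneg (truncPsi_nonneg _ _) (by positivity)) (fun N => ?_) hs
  rw [hilbertIter_odd_eq]
  have hnn : ∀ j, 0 ≤ truncPsi N (2 * j) / ((N : ℝ) + 1) ^ 2 * coeff k
      (evenSeries 0 * evenSeries 0 * (X * (evenSeries 0 * evenSeries 0)) ^ j) := fun j => by
    refine mul_nonneg (div_nonneg (truncPsi_nonneg _ _) (by positivity)) ?_
    rw [coeff_sq_mul_shift]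
    split_ifs
    · exact coeff_evenSeries_pow_nonneg _ _
    · exact le_rfl
  refine le_trans (le_of_eq ?_) (Finset.single_le_sum (fun j _ => hnn j)
    (Finset.mem_range.2 (Nat.lt_succ_self k)))
  rw [coeff_sq_mul_shift, if_pos le_rfl, Nat.sub_self]
  have : coeff 0 (evenSeries 0 ^ (2 * k + 2)) = 1 := by
    rw [PowerSeries.coeff_zero_eq_constantCoeff_apply, map_pow,
      ← PowerSeries.coeff_zero_eq_constantCoeff_apply, coeff_zero_evenSeries, one_pow]
  rw [this, mul_one]

/-- The equation `ρ = Ψ(X ρ²)` for `ρ = evenSeries 0`, with `Ψ` the generating series of `psiSeries`. -/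
theorem evenSeries_zero_eq :
    evenSeries 0 = shiftEval (evenSeries 0 * evenSeries 0) psiSeries := by
  have h1 : psiSeries = fun k => Nat.casesOn k 1 (fun k => psiSeries (k + 1)) := by
    funext k; rcases k with _ | k <;> rfl
  rw [h1, shiftEval_cons, mul_assoc]
  ext n
  rcases n with _ | n
  · simp [PowerSeries.coeff_zero_eq_constantCoeff_apply, ← coeff_zero_evenSeries]
  rw [map_add, PowerSeries.coeff_succ_X_mul, coeff_mul_shiftEval, PowerSeries.coeff_C,
    if_neg (Nat.succ_ne_zero n), zero_add]
  have h2 : coeff (n + 1) (evenSeries 0) = ∑' N : ℕ, hilbertIter (2 * n + 1) N / ((N : ℝ) + 1) := by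
    rw [evenSeries, PowerSeries.coeff_mk, show 2 * (n + 1) = 2 * n + 1 + 1 by ring]
    simp [hilbertIter, hilbertMap]
  rw [h2]
  simp_rw [hilbertIter_odd_eq]
  rw [Summable.tsum_finsetSum fun k _ => (summable_truncPsi k).mul_right _]
  simp_rw [tsum_mul_right]
  rfl

/-- Replace just one factor `ρ` of the power by `Ψ(X ρ²)`. -/
theorem coeff_evenSeries_pow_succ (m n : ℕ) :
    coeff n (evenSeries 0 ^ (m + 1)) = ∑ k ∈ Finset.range (n + 1),
      psiSeries k * coeff (n - k) (evenSeries 0 ^ (m + 2 * k)) := by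
  conv_lhs => rw [pow_succ]; arg 2; arg 2; rw [evenSeries_zero_eq]
  rw [coeff_mul_shiftEval]
  refine Finset.sum_congr rfl fun k hk => ?_
  rw [coeff_mul_X_mul_pow, if_pos (by simpa [Nat.lt_succ_iff] using hk), pow_add, pow_mul, sq]

theorem betaCoeff_psiSeries (L m n : ℕ) (h : L + 2 = m + 1 + 2 * n) :
    betaCoeff psiSeries (L + 2) m = coeff n (evenSeries 0 ^ m) := by
  induction L generalizing m n with
  | zero =>
    obtain ⟨rfl, rfl⟩ : m = 1 ∧ n = 0 := by omega
    simp [betaCoeff, coeff_zero_evenSeries, - PowerSeries.coeff_zero_eq_constantCoeff]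
  | succ L ih =>
    rcases m with _ | m
    -- Here `n > 0`, so the convention `β_0 = 0` agrees with `ρ^0 = 1`.
    · rw [pow_zero, PowerSeries.coeff_one, if_neg (by omega), betaCoeff]
    · rw [betaCoeff, if_pos ⟨by omega, by unfold Nat.ModEq; omega⟩, coeff_evenSeries_pow_succ]
      rw [show (L + 2 - (m + 1)) / 2 = n by omega]
      refine Finset.sum_congr rfl fun k hk => ?_
      have := Finset.mem_range.1 hk
      rw [ih (m + 2 * k) (n - k) (by omega)]

theorem betaCoeff_psiSeries_one (n : ℕ) :
    betaCoeff psiSeries (2 * n + 2) 1 = hilbertIter (2 * n) 0 := by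
  rw [betaCoeff_psiSeries (2 * n) 1 n (by omega), pow_one, evenSeries, PowerSeries.coeff_mk]

theorem betaCoeff_psiSeries_two (n : ℕ) :
    betaCoeff psiSeries (2 * n + 1 + 2) 2 = hilbertIter (2 * n + 1) 0 := by
  rw [betaCoeff_psiSeries (2 * n + 1) 2 n (by omega), sq, ← oddSeries_zero, oddSeries,
    PowerSeries.coeff_mk]

/-! ### Multiple zeta values as nested sums -/

/-- The truncated multiple zeta value `∑_{0 < k₁ < ⋯ < k_r ≤ N} ∏ 1 / kⱼ ^ mⱼ`. -/
noncomputable def mzvBelow {r : ℕ} (m : Fin r → ℕ) (N : ℕ∞) : ENNReal :=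
  open Classical in
  ∑' k : Fin r → ℕ, if StrictMono k ∧ ∀ j, 0 < k j ∧ (k j : ℕ∞) ≤ N then
    ENNReal.ofReal (∏ j, (1 : ℝ) / (k j : ℝ) ^ m j) else 0

theorem strictMono_snoc_iff {r : ℕ} (k : Fin r → ℕ) (a : ℕ) (N : ℕ∞) :
    (StrictMono (Fin.snoc k a : Fin (r + 1) → ℕ) ∧
      ∀ j, 0 < (Fin.snoc k a : Fin (r + 1) → ℕ) j ∧
        (((Fin.snoc k a : Fin (r + 1) → ℕ) j : ℕ) : ℕ∞) ≤ N) ↔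
    (0 < a ∧ (a : ℕ∞) ≤ N) ∧ StrictMono k ∧ ∀ j, 0 < k j ∧ (k j : ℕ∞) ≤ ((a - 1 : ℕ) : ℕ∞) := by
  constructor
  · rintro ⟨h1, h2⟩
    have ha := h2 (Fin.last r)
    simp only [Fin.snoc_last] at ha
    refine ⟨ha, fun i j hij => ?_, fun j => ⟨?_, ?_⟩⟩
    · simpa using h1 (Fin.castSucc_lt_castSucc_iff.2 hij)
    · simpa using (h2 j.castSucc).1
    · have := h1 (Fin.castSucc_lt_last j)
      simp only [Fin.snoc_castSucc, Fin.snoc_last] at this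
      exact_mod_cast Nat.le_sub_one_of_lt this
  · rintro ⟨⟨ha, haN⟩, h1, h2⟩
    have hlt : ∀ j, k j < a := fun j => by
      have : k j ≤ a - 1 := by exact_mod_cast (h2 j).2
      omega
    refine ⟨fun i j hij => ?_, fun j => ?_⟩
    · induction j using Fin.lastCases with
      | last =>
        induction i using Fin.lastCases with
        | last => exact absurd hij (lt_irrefl _)
        | cast i => simpa using hlt i
      | cast j =>
        induction i using Fin.lastCases with
        | last => exact absurd (hij.trans (Fin.castSucc_lt_last j)) (lt_irrefl _)
        | cast i => simpa using h1 (Fin.castSucc_lt_castSucc_iff.1 hij)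
    · induction j using Fin.lastCases with
      | last => simpa using ⟨ha, haN⟩
      | cast j =>
        simp only [Fin.snoc_castSucc]
        exact ⟨(h2 j).1, le_trans (by exact_mod_cast (hlt j).le) haN⟩

/-- Split off the largest variable, written `a + 1`, so that the others are bounded by `a`. Values
in `ENNReal` make the rearrangement unconditional, and `N = ⊤` covers the full series. -/
theorem mzvBelow_succ {r : ℕ} (m : Fin (r + 1) → ℕ) (N : ℕ∞) :
    mzvBelow m N = ∑' a : ℕ, if ((a + 1 : ℕ) : ℕ∞) ≤ N then
      ENNReal.ofReal (1 / ((a : ℝ) + 1) ^ m (Fin.last r)) *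
        mzvBelow (fun j => m j.castSucc) a else 0 := by
  classical
  have h : mzvBelow m N = ∑' a : ℕ, if 0 < a ∧ (a : ℕ∞) ≤ N then
      ENNReal.ofReal (1 / (a : ℝ) ^ m (Fin.last r)) *
        mzvBelow (fun j => m j.castSucc) ((a - 1 : ℕ) : ℕ∞) else 0 := by
    unfold mzvBelow
    rw [← (Fin.snocEquiv (fun _ : Fin (r + 1) => ℕ)).tsum_eq, ENNReal.tsum_prod']
    refine tsum_congr fun a => ?_
    split_ifs with ha
    · rw [← ENNReal.tsum_mul_left]
      refine tsum_congr fun k => ?_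
      change (if StrictMono (Fin.snoc k a : Fin (r + 1) → ℕ) ∧
          ∀ j, 0 < (Fin.snoc k a : Fin (r + 1) → ℕ) j ∧
            (((Fin.snoc k a : Fin (r + 1) → ℕ) j : ℕ) : ℕ∞) ≤ N then ENNReal.ofReal
          (∏ j, (1 : ℝ) / ((Fin.snoc k a : Fin (r + 1) → ℕ) j : ℝ) ^ m j) else 0) = _
      have := strictMono_snoc_iff k a N
      by_cases hk : StrictMono k ∧ ∀ j, 0 < k j ∧ (k j : ℕ∞) ≤ ((a - 1 : ℕ) : ℕ∞)
      · rw [if_pos (this.2 ⟨ha, hk⟩), if_pos hk, Fin.prod_univ_castSucc, mul_comm,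
          ENNReal.ofReal_mul (by positivity)]
        simp
      · rw [if_neg fun h => hk (this.1 h).2, if_neg hk, mul_zero]
    · refine ENNReal.tsum_eq_zero.2 fun k => ?_
      exact if_neg fun h => ha ((strictMono_snoc_iff k a N).1 h).1
  rw [h, tsum_eq_zero_add' ENNReal.summable]
  simp

/-- The truncated multiple zeta value as a finite nested sum; the exponent of the largest summation
variable comes first. -/
noncomputable def nestedSum : List ℕ → ℕ → ℝ
  | [], _ => 1
  | m :: w, N => ∑ a ∈ Finset.range N, nestedSum w a / ((a : ℝ) + 1) ^ m

theorem nestedSum_nonneg (w : List ℕ) (N : ℕ) : 0 ≤ nestedSum w N := by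
  induction w generalizing N with
  | nil => exact zero_le_one
  | cons m w ih => exact Finset.sum_nonneg fun a _ => div_nonneg (ih a) (by positivity)

theorem mzvBelow_eq_nestedSum {r : ℕ} (m : Fin r → ℕ) (N : ℕ) :
    mzvBelow m N = ENNReal.ofReal (nestedSum (List.ofFn m).reverse N) := by
  classical
  induction r generalizing N with
  | zero => simp [mzvBelow, nestedSum, Subsingleton.strictMono]
  | succ r ih =>
    rw [mzvBelow_succ, List.ofFn_succ', List.concat_eq_append, List.reverse_append,
      List.reverse_singleton, List.singleton_append, nestedSum,
      ENNReal.ofReal_sum_of_nonneg fun a _ => div_nonneg (nestedSum_nonneg _ _) (by positivity)]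
    rw [tsum_eq_sum (s := Finset.range N)]
    · refine Finset.sum_congr rfl fun a ha => ?_
      rw [if_pos (by exact_mod_cast Finset.mem_range.1 ha), ih,
        ← ENNReal.ofReal_mul (by positivity), one_div_mul_eq_div]
    · intro a ha
      refine if_neg fun h => ha (Finset.mem_range.2 ?_)
      exact_mod_cast h

theorem mzv_eq_tsum {r : ℕ} (m : Fin r → ℕ) (a : ℕ) (w : List ℕ)
    (h : (List.ofFn m).reverse = a :: w) :
    mzv m = ∑' N : ℕ, nestedSum w N / ((N : ℝ) + 1) ^ a := by
  classical
  rcases r with _ | r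
  · simp at h
  rw [List.ofFn_succ', List.concat_eq_append, List.reverse_append, List.reverse_singleton,
    List.singleton_append, List.cons.injEq] at h
  have h1 : mzv m = (mzvBelow m ⊤).toReal := by
    unfold mzv mzvBelow
    rw [ENNReal.tsum_toReal_eq fun k => by split_ifs <;> simp]
    refine (tsum_subtype {k : Fin (r + 1) → ℕ | StrictMono k ∧ ∀ j, 0 < k j}
      (fun k => ∏ j, (1 : ℝ) / (k j : ℝ) ^ m j)).trans (tsum_congr fun k => ?_)
    simp only [Set.indicator_apply, Set.mem_ofPred_eq, le_top, and_true]
    split_ifs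
    · rw [ENNReal.toReal_ofReal (by positivity)]
    · rfl
  rw [h1, mzvBelow_succ, ENNReal.tsum_toReal_eq]
  · refine tsum_congr fun N => ?_
    rw [if_pos le_top, mzvBelow_eq_nestedSum, h.1, h.2, ENNReal.toReal_mul,
      ENNReal.toReal_ofReal (by positivity), ENNReal.toReal_ofReal (nestedSum_nonneg _ _),
      one_div_mul_eq_div]
  · intro N
    rw [if_pos le_top, mzvBelow_eq_nestedSum]
    exact ENNReal.mul_ne_top ENNReal.ofReal_ne_top ENNReal.ofReal_ne_top

/-! ### Matching the indices of `ψ` with words -/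

/-- The reversed words of weight `s` in the letters `1` and `2` in which every `2` is preceded by an
even weight. -/
def psiWords : ℕ → Finset (List ℕ)
  | 0 => {[]}
  | 1 => {[1]}
  | s + 2 => (psiWords (s + 1)).image (List.cons 1) ∪
      if Even s then (psiWords s).image (List.cons 2) else ∅

/-- All letters are `1` or `2`, and every `2` is followed by an even weight. -/
def IsPsiWord : List ℕ → Prop
  | [] => True
  | m :: w => (m = 1 ∨ m = 2 ∧ Even w.sum) ∧ IsPsiWord w

theorem mem_psiWords {s : ℕ} {w : List ℕ} : w ∈ psiWords s ↔ IsPsiWord w ∧ w.sum = s := by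
  induction s using Nat.twoStepInduction generalizing w with
  | zero =>
    rcases w with _ | ⟨m, w⟩
    · simp [psiWords, IsPsiWord]
    · simp only [psiWords, Finset.mem_singleton, reduceCtorEq, IsPsiWord, List.sum_cons, false_iff]
      omega
  | one =>
    rcases w with _ | ⟨m, _ | ⟨m', w⟩⟩
    · simp [psiWords]
    · simp only [psiWords, Finset.mem_singleton, IsPsiWord]
      simp
      exact Or.inl
    · simp only [psiWords, Finset.mem_singleton, IsPsiWord, List.sum_cons]
      simp
      omega
  | more s ih0 ih1 =>
    rcases w with _ | ⟨m, w⟩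
    · simp only [psiWords]
      split_ifs <;> simp
    · simp only [psiWords, Finset.mem_union, Finset.mem_image, List.cons.injEq, IsPsiWord,
        List.sum_cons]
      constructor
      · rintro (⟨v, hv, h1, h2⟩ | h)
        · have := ih1.1 hv
          subst h1 h2
          exact ⟨⟨Or.inl rfl, this.1⟩, by omega⟩
        · split_ifs at h with hs
          · obtain ⟨v, hv, h2⟩ := Finset.mem_image.1 h
            obtain ⟨h3, h4⟩ := List.cons.inj h2
            subst h3 h4
            have := ih0.1 hv
            exact ⟨⟨Or.inr ⟨rfl, by rwa [this.2]⟩, this.1⟩, by omega⟩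
          · simp at h
      · rintro ⟨⟨rfl | ⟨rfl, he⟩, hw⟩, hs⟩
        · exact Or.inl ⟨w, ih1.2 ⟨hw, by omega⟩, rfl, rfl⟩
        · have hs' : w.sum = s := by omega
          rw [if_pos (hs' ▸ he)]
          exact Or.inr (Finset.mem_image_of_mem _ (ih0.2 ⟨hw, hs'⟩))

theorem sum_psiWords_add_two (s : ℕ) (f : List ℕ → ℝ) :
    ∑ w ∈ psiWords (s + 2), f w = ∑ w ∈ psiWords (s + 1), f (1 :: w) +
      if Even s then ∑ w ∈ psiWords s, f (2 :: w) else 0 := by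
  rw [psiWords, Finset.sum_union, Finset.sum_image (by simp)]
  · split_ifs
    · rw [Finset.sum_image (by simp)]
    · simp
  · split_ifs
    · rw [Finset.disjoint_left]
      simp only [Finset.mem_image]
      rintro _ ⟨v, -, rfl⟩ ⟨u, -, h⟩
      simp at h
    · simp

theorem truncPsi_eq_sum (N s : ℕ) : truncPsi N s = ∑ w ∈ psiWords s, nestedSum w N := by
  induction N generalizing s with
  | zero =>
    rcases s with _ | s
    · simp [truncPsi, psiWords, nestedSum]
    · rw [truncPsi, if_neg (Nat.succ_ne_zero s)]
      refine (Finset.sum_eq_zero fun w hw => ?_).symm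
      rcases w with _ | ⟨m, w⟩
      · simpa using (mem_psiWords.1 hw).2
      · simp [nestedSum]
  | succ N ih =>
    have hstep : ∀ m w, nestedSum (m :: w) (N + 1)
        = nestedSum (m :: w) N + nestedSum w N / ((N : ℝ) + 1) ^ m := fun m w => by
      simp [nestedSum, Finset.sum_range_succ]
    rcases s with _ | _ | s
    · rw [truncPsi, ih]; simp [psiWords, nestedSum]
    · rw [truncPsi, ih, ih]; simp [psiWords, nestedSum, Finset.sum_range_succ]
    · rw [truncPsi, ih, ih, ih, sum_psiWords_add_two, sum_psiWords_add_two]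
      simp only [hstep, Finset.sum_add_distrib, Finset.sum_div, pow_one]
      split_ifs <;> ring

theorem isPsiWord_reverse_iff (l : List ℕ) : IsPsiWord l.reverse ↔
    (∀ m ∈ l, m = 1 ∨ m = 2) ∧
      ∀ (i : ℕ) (h : i < l.length), l[i] = 2 → Even (l.take i).sum := by
  induction l using List.reverseRecOn with
  | nil => simp [IsPsiWord]
  | append_singleton l a ih =>
    rw [List.reverse_append, List.reverse_singleton, List.singleton_append, IsPsiWord, ih,
      List.sum_reverse]
    constructor
    · rintro ⟨ha, h1, h2⟩
      refine ⟨fun m hm => ?_, fun i hi h => ?_⟩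
      · rcases List.mem_append.1 hm with hm | hm
        · exact h1 m hm
        · rw [List.mem_singleton.1 hm]; tauto
      · rw [List.length_append, List.length_singleton] at hi
        rw [List.take_append_of_le_length (by omega)]
        rcases Nat.lt_succ_iff_lt_or_eq.1 hi with hi | rfl
        · exact h2 i hi (by rwa [List.getElem_append_left hi] at h)
        · have : a = 2 := by simpa using h
          rw [List.take_length]
          rcases ha with ha | ha
          · omega
          · exact ha.2
    · rintro ⟨h1, h2⟩
      refine ⟨?_, fun m hm => h1 m (List.mem_append_left _ hm), fun i hi h => ?_⟩
      · rcases h1 a (by simp) with ha | ha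
        · exact Or.inl ha
        · refine Or.inr ⟨ha, ?_⟩
          have := h2 l.length (by simp) (by simpa using ha)
          simpa using this
      · have := h2 i (by simp; omega) (by rwa [List.getElem_append_left hi])
        rwa [List.take_append_of_le_length hi.le] at this

theorem isPsiIndex_iff {N : ℕ} (c : Composition N) :
    IsPsiIndex c ↔ ∃ w, c.blocks.reverse = 2 :: w ∧ IsPsiWord (2 :: w) := by
  have h : ((∀ m ∈ c.blocks, m = 1 ∨ m = 2) ∧
      ∀ j : Fin c.length, c.blocksFun j = 2 → Even (c.sizeUpTo j)) ↔
      IsPsiWord c.blocks.reverse := by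
    rw [isPsiWord_reverse_iff]
    exact and_congr_right fun _ => ⟨fun h i hi h2 => h ⟨i, hi⟩ h2, fun h j h2 => h j.1 j.2 h2⟩
  rw [IsPsiIndex, h]
  constructor
  · rintro ⟨h1, h2⟩
    obtain ⟨l, hl⟩ := List.getLast?_eq_some_iff.1 h1
    refine ⟨l.reverse, by simp [hl], ?_⟩
    simpa [hl] using h2
  · rintro ⟨w, hw, h2⟩
    rw [hw]
    refine ⟨?_, h2⟩
    rw [← List.head?_reverse, hw, List.head?_cons]

/-- Reverse an index and drop its leading `2`; the remaining weight `2 k` is even, so restoring the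
`2` is always permitted. -/
theorem evenPsi_succ (k : ℕ) : evenPsi (k + 1) =
    ∑ w ∈ psiWords (2 * k), ∑' N : ℕ, nestedSum w N / ((N : ℝ) + 1) ^ 2 := by
  rw [evenPsi, if_neg (Nat.succ_ne_zero k)]
  refine Finset.sum_nbij (fun c => c.blocks.reverse.tail) ?_ ?_ ?_ ?_
  · intro c hc
    obtain ⟨w, hw, h2⟩ := (isPsiIndex_iff c).1 (Finset.mem_filter.1 hc).2
    rw [hw, List.tail_cons]
    refine mem_psiWords.2 ⟨h2.2, ?_⟩
    have := c.blocks_sum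
    rw [← List.sum_reverse, hw, List.sum_cons] at this
    omega
  · intro c hc d hd h
    obtain ⟨w, hw, -⟩ := (isPsiIndex_iff c).1 (Finset.mem_filter.1 hc).2
    obtain ⟨v, hv, -⟩ := (isPsiIndex_iff d).1 (Finset.mem_filter.1 hd).2
    simp only [hw, hv, List.tail_cons] at h
    refine Composition.ext (List.reverse_injective ?_)
    rw [hw, hv, h]
  · intro w hw
    obtain ⟨h1, h2⟩ := mem_psiWords.1 hw
    have hpos : ∀ w : List ℕ, IsPsiWord w → ∀ i ∈ w, 0 < i := fun w => by
      induction w with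
      | nil => simp
      | cons m w ih =>
        rintro ⟨hm, hw⟩ i hi
        rcases List.mem_cons.1 hi with rfl | hi
        · omega
        · exact ih hw i hi
    have hw2 : IsPsiWord (2 :: w) := ⟨Or.inr ⟨rfl, by simp [h2]⟩, h1⟩
    refine ⟨⟨(2 :: w).reverse, fun hi => hpos _ hw2 _ (List.mem_reverse.1 hi), ?_⟩, ?_, ?_⟩
    · rw [List.sum_reverse, List.sum_cons, h2]; ring
    · exact Finset.mem_filter.2 ⟨Finset.mem_univ _, (isPsiIndex_iff _).2 ⟨w, by simp, hw2⟩⟩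
    · simp
  · intro c hc
    obtain ⟨w, hw, h2⟩ := (isPsiIndex_iff c).1 (Finset.mem_filter.1 hc).2
    rw [hw, List.tail_cons]
    exact mzv_eq_tsum _ 2 w (by rw [Composition.ofFn_blocksFun, hw])

theorem psiSeries_eq_evenPsi : psiSeries = evenPsi := by
  funext k
  rcases k with _ | k
  · simp [psiSeries, evenPsi]
  have hs : ∀ w ∈ psiWords (2 * k), Summable fun N : ℕ => nestedSum w N / ((N : ℝ) + 1) ^ 2 := by
    intro w hw
    refine Summable.of_nonneg_of_le
      (fun N => div_nonneg (nestedSum_nonneg _ _) (by positivity)) (fun N => ?_)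
      (summable_truncPsi k)
    rw [truncPsi_eq_sum]
    gcongr
    exact Finset.single_le_sum (fun v _ => nestedSum_nonneg v N) hw
  rw [evenPsi_succ, ← Summable.tsum_finsetSum hs, psiSeries]
  simp_rw [truncPsi_eq_sum, Finset.sum_div]

/-! ### The cube integral as a matrix entry -/

/-- Iterated integrals of the kernel `1 / (1 - t y)` over `[0, 1]`, applied to the constant `1`. -/
noncomputable def cubeIter : ℕ → ℝ → ENNReal
  | 0, _ => 1
  | n + 1, t => ∫⁻ y in Set.Icc (0 : ℝ) 1, ENNReal.ofReal (1 / (1 - t * y)) * cubeIter n y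

theorem ofReal_one_div_one_sub {x : ℝ} (h0 : 0 ≤ x) (h1 : x < 1) :
    ENNReal.ofReal (1 / (1 - x)) = ∑' m : ℕ, ENNReal.ofReal (x ^ m) := by
  rw [← ENNReal.ofReal_tsum_of_nonneg (fun m => pow_nonneg h0 m)
    (summable_geometric_of_lt_one h0 h1), tsum_geometric_of_lt_one h0 h1, one_div]

theorem setLIntegral_ofReal_mul_pow {c : ℝ} (hc : 0 ≤ c) (j : ℕ) :
    ∫⁻ y in Set.Ico (0 : ℝ) 1, ENNReal.ofReal (c * y ^ j) = ENNReal.ofReal (c / ((j : ℝ) + 1)) := by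
  rw [restrict_Ico_eq_restrict_Ioc, ← ofReal_integral_eq_lintegral_ofReal,
    ← intervalIntegral.integral_of_le zero_le_one]
  · simp [div_eq_mul_inv]
  · refine (intervalIntegrable_iff_integrableOn_Ioc_of_le zero_le_one).1 ?_
    exact (by fun_prop : Continuous fun y : ℝ => c * y ^ j).intervalIntegrable 0 1
  · refine (ae_restrict_iff' measurableSet_Ioc).2 (Filter.Eventually.of_forall fun y hy => ?_)
    exact mul_nonneg hc (pow_nonneg hy.1.le j)

/-- The kernel `1 / (1 - t y)` acts on power series coefficients as the Hilbert matrix, because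
`y^(m + k)` integrates to `1 / (m + k + 1)`. -/
theorem cubeIter_eq_tsum (n : ℕ) {t : ℝ} (h0 : 0 ≤ t) (h1 : t < 1) :
    cubeIter n t = ∑' k : ℕ, ENNReal.ofReal (hilbertIter n k * t ^ k) := by
  induction n generalizing t with
  | zero =>
    rw [tsum_eq_single 0 fun k hk => by simp [hilbertIter, hk]]
    simp [cubeIter, hilbertIter]
  | succ n ih =>
    have hexp : ∀ y ∈ Set.Ico (0 : ℝ) 1, ENNReal.ofReal (1 / (1 - t * y)) * cubeIter n y
        = ∑' m : ℕ, ∑' k : ℕ, ENNReal.ofReal (t ^ m * hilbertIter n k * y ^ (m + k)) := by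
      intro y hy
      rw [ih hy.1 hy.2, ofReal_one_div_one_sub (mul_nonneg h0 hy.1)
        (by nlinarith [hy.1, hy.2]), ← ENNReal.tsum_mul_right]
      refine tsum_congr fun m => ?_
      rw [← ENNReal.tsum_mul_left]
      refine tsum_congr fun k => ?_
      rw [← ENNReal.ofReal_mul (pow_nonneg (mul_nonneg h0 hy.1) m)]
      congr 1
      ring
    -- The endpoint `y = 1`, where the expansion is not available, is a null set.
    rw [cubeIter, ← restrict_Ico_eq_restrict_Icc, setLIntegral_congr_fun measurableSet_Ico hexp,
      lintegral_tsum fun m => by fun_prop]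
    refine tsum_congr fun m => ?_
    rw [lintegral_tsum fun k => by fun_prop]
    have hs := (powDecay_hilbertIter n).summable m
    rw [hilbertIter, hilbertMap, mul_comm, ← tsum_mul_left, ENNReal.ofReal_tsum_of_nonneg
      (fun k => mul_nonneg (pow_nonneg h0 m) (div_nonneg (hilbertIter_nonneg n k) (by positivity)))
      (hs.mul_left _)]
    refine tsum_congr fun k => ?_
    rw [setLIntegral_ofReal_mul_pow (mul_nonneg (pow_nonneg h0 m) (hilbertIter_nonneg n k))]
    push_cast
    rw [mul_div_assoc]

theorem xiIntegrand_cons_cons (n : ℕ) (t y : ℝ) (x : Fin n → ℝ) :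
    xiIntegrand (n + 2) (Fin.cons t (Fin.cons y x))
      = 1 / (1 - t * y) * xiIntegrand (n + 1) (Fin.cons y x) := by
  refine (Fin.prod_univ_succ (n := n) _).trans ?_
  rfl

theorem measurable_xiIntegrand (l : ℕ) : Measurable (xiIntegrand l) := by
  unfold xiIntegrand
  fun_prop

theorem setLIntegral_cube_succ (n : ℕ) {G : (Fin (n + 1) → ℝ) → ENNReal} (hG : Measurable G) :
    ∫⁻ x in Set.Icc (0 : Fin (n + 1) → ℝ) 1, G x
      = ∫⁻ y in Set.Icc (0 : ℝ) 1, ∫⁻ x in Set.Icc (0 : Fin n → ℝ) 1, G (Fin.cons y x) := by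
  have hmp := (volume_preserving_piFinSuccAbove (fun _ : Fin (n + 1) => ℝ) 0).symm
  have hsymm : ∀ p : ℝ × (Fin n → ℝ),
      (MeasurableEquiv.piFinSuccAbove (fun _ : Fin (n + 1) => ℝ) 0).symm p = Fin.cons p.1 p.2 :=
    fun p => by
      simp [MeasurableEquiv.piFinSuccAbove]
      rfl
  have hpre : (MeasurableEquiv.piFinSuccAbove (fun _ : Fin (n + 1) => ℝ) 0).symm ⁻¹'
      Set.Icc (0 : Fin (n + 1) → ℝ) 1 = Set.Icc (0 : ℝ) 1 ×ˢ Set.Icc (0 : Fin n → ℝ) 1 := by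
    ext p
    simp only [Set.mem_preimage, hsymm, Set.mem_Icc, Set.mem_prod, Pi.le_def, Fin.forall_fin_succ,
      Fin.cons_zero, Fin.cons_succ, Pi.zero_apply, Pi.one_apply]
    tauto
  have hmeas : Measurable fun p : ℝ × (Fin n → ℝ) => G (Fin.cons p.1 p.2) := by
    have := hG.comp (MeasurableEquiv.piFinSuccAbove (fun _ : Fin (n + 1) => ℝ) 0).symm.measurable
    simpa only [Function.comp_def, hsymm] using this
  rw [← hmp.setLIntegral_comp_preimage_emb (MeasurableEquiv.measurableEmbedding _), hpre]
  simp_rw [hsymm]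
  rw [Measure.volume_eq_prod, ← Measure.prod_restrict, lintegral_prod _ hmeas.aemeasurable]

theorem lintegral_xiIntegrand_cons (n : ℕ) {t : ℝ} (h0 : 0 ≤ t) (h1 : t ≤ 1) :
    ∫⁻ x in Set.Icc (0 : Fin n → ℝ) 1, ENNReal.ofReal (xiIntegrand (n + 1) (Fin.cons t x))
      = cubeIter n t := by
  have hcons : ∀ (n : ℕ) (t : ℝ), Measurable fun x : Fin n → ℝ =>
      ENNReal.ofReal (xiIntegrand (n + 1) (Fin.cons t x)) := fun n t => by
    refine ENNReal.measurable_ofReal.comp ((measurable_xiIntegrand (n + 1)).comp ?_)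
    refine measurable_pi_lambda _ fun i => ?_
    induction i using Fin.cases with
    | zero => simp
    | succ i => simpa using measurable_pi_apply i
  induction n generalizing t with
  | zero =>
    have : Set.Icc (0 : Fin 0 → ℝ) 1 = Set.univ := by
      ext x; simp [Subsingleton.elim x 0]
    rw [this]
    simp [cubeIter, xiIntegrand, volume_pi]
  | succ n ih =>
    rw [setLIntegral_cube_succ n (hcons (n + 1) t), cubeIter]
    refine setLIntegral_congr_fun measurableSet_Icc fun y hy => ?_
    have hnn : 0 ≤ 1 / (1 - t * y) :=
      one_div_nonneg.2 (by nlinarith [hy.1, hy.2])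
    simp only [xiIntegrand_cons_cons, ENNReal.ofReal_mul hnn]
    rw [lintegral_const_mul _ (hcons n y), ih hy.1 hy.2]

theorem lintegral_xiIntegrand (l : ℕ) (hl : l ≠ 0) :
    ∫⁻ x in Set.Icc (0 : Fin l → ℝ) 1, ENNReal.ofReal (xiIntegrand l x)
      = ENNReal.ofReal (hilbertIter l 0) := by
  obtain ⟨n, rfl⟩ := Nat.exists_eq_succ_of_ne_zero hl
  -- An extra coordinate `0` in front contributes the factor `1` and selects the constant
  -- coefficient.
  have h : ∀ x : Fin (n + 1) → ℝ, xiIntegrand (n + 1) x = xiIntegrand (n + 2) (Fin.cons 0 x) :=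
    fun x => by
      rw [← Fin.cons_self_tail x, xiIntegrand_cons_cons]
      simp
  simp only [Nat.succ_eq_add_one, h]
  rw [lintegral_xiIntegrand_cons (n + 1) le_rfl zero_le_one, cubeIter_eq_tsum _ le_rfl one_pos,
    tsum_eq_single 0 fun k hk => by simp [hk]]
  simp

theorem xiIntegrand_nonneg {l : ℕ} {x : Fin l → ℝ} (hx : x ∈ Set.Icc (0 : Fin l → ℝ) 1) :
    0 ≤ xiIntegrand l x := by
  refine Finset.prod_nonneg fun i _ => one_div_nonneg.2 (sub_nonneg.2 ?_)
  exact mul_le_one₀ (hx.2 _) (hx.1 _) (hx.2 _)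

theorem integrableOn_xiIntegrand (l : ℕ) (hl : l ≠ 0) :
    IntegrableOn (xiIntegrand l) (Set.Icc (0 : Fin l → ℝ) 1) volume := by
  refine ⟨(measurable_xiIntegrand l).aestronglyMeasurable, ?_⟩
  rw [hasFiniteIntegral_iff_ofReal
    ((ae_restrict_iff' measurableSet_Icc).2 (Filter.Eventually.of_forall fun x => xiIntegrand_nonneg)),
    lintegral_xiIntegrand l hl]
  exact ENNReal.ofReal_lt_top

theorem xiInt_eq_hilbertIter (l : ℕ) (hl : l ≠ 0) : xiInt l = hilbertIter l 0 := by
  rw [xiInt, integral_eq_lintegral_of_nonneg_ae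
    ((ae_restrict_iff' measurableSet_Icc).2 (Filter.Eventually.of_forall fun x => xiIntegrand_nonneg))
    (measurable_xiIntegrand l).aestronglyMeasurable, lintegral_xiIntegrand l hl,
    ENNReal.toReal_ofReal (hilbertIter_nonneg l 0)]

theorem mainTheorem1 (l : ℕ) (hl : 2 ≤ l) :
    IntegrableOn (xiIntegrand l) (Set.Icc (0 : Fin l → ℝ) 1) volume ∧
      (Even l → xiInt l = betaCoeff evenPsi (l + 2) 1) ∧
      (Odd l → xiInt l = betaCoeff evenPsi (l + 2) 2) := by
  have hl0 : l ≠ 0 := by omega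
  refine ⟨integrableOn_xiIntegrand l hl0, fun he => ?_, fun ho => ?_⟩
  · obtain ⟨n, rfl⟩ := even_iff_exists_two_mul.1 he
    rw [xiInt_eq_hilbertIter _ hl0, ← psiSeries_eq_evenPsi, betaCoeff_psiSeries_one]
  · obtain ⟨n, rfl⟩ := ho
    rw [xiInt_eq_hilbertIter _ hl0, ← psiSeries_eq_evenPsi, betaCoeff_psiSeries_two]
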